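/- Let $k\in\mathbb{N}$. A generalized quantifier of type $\langle k\rangle$ on $\mathbb{N}$ is a family $Q$ of subsets of $\mathbb{N}^k$. For $A\subseteq\mathbb{N}^k$ let $Q_A=\{X\subseteq\mathbb{N}^k : A\subseteq X\}$. Let $\mathrm{Aut}(Q)$ be the group of permutations $g$ of $\mathbb{N}$ such that $X\in Q\iff g(X)\in Q$ for all $X\subseteq\mathbb{N}^k$, where $g$ acts on $\mathbb{N}^k$ coordinatewise. Let $\mathscr{L}_{\omega_1\omega}(Q)$ be the logic (over the empty signature, with equality) with countable conjunctions and disjunctions, the usual first-order quantifiers, and a quantifier symbol $Q$ binding $k$ variables, where $Qx\,\varphi(x,b)$ holds in $\mathbb{N}$ if and only if $\{x\in\mathbb{N}^k : \varphi(x,b)\}\in Q$. If $Q$ is a finite boolean combination of quantifiers of the form $Q_A$ with $A\subseteq\mathbb{N}^k$, then for every $n\in\mathbb{N}$ and every $a\in\mathbb{N}^n$, the orbit $\{g(a) : g\in\mathrm{Aut}(Q)\}\subseteq\mathbb{N}^n$ is definable in $\mathscr{L}_{\omega_1\omega}(Q)$ by a formula without parameters. -/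

import Mathlib

namespace GenQuant

/-- A generalized quantifier of type `⟨k⟩` on the natural numbers: a set of subsets of `ℕ^k`. -/
abbrev Quantifier (k : ℕ) : Type := Set (Set (Fin k → ℕ))

/-- The principal quantifier `Q_A = {X ⊆ ℕ^k : A ⊆ X}`. -/
def principal {k : ℕ} (A : Set (Fin k → ℕ)) : Quantifier k := {X | A ⊆ X}

/-- `Q` is a finite boolean combination of principal quantifiers `Q_A` with `A ⊆ ℕ^k`, i.e. it
belongs to the boolean algebra of sets generated by them (complements, finite unions and finite
intersections). -/
def IsBooleanCombinationOfPrincipal {k : ℕ} (Q : Quantifier k) : Prop :=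
  Q ∈ BooleanSubalgebra.closure (Set.range (principal (k := k)))

/-- The image `g(X)` of `X ⊆ ℕ^k` under the coordinatewise action of a permutation `g` of `ℕ`. -/
def permImage {k : ℕ} (g : Equiv.Perm ℕ) (X : Set (Fin k → ℕ)) : Set (Fin k → ℕ) :=
  (fun x i => g (x i)) '' X

theorem permImage_one {k : ℕ} (X : Set (Fin k → ℕ)) : permImage 1 X = X := by
  simp [permImage]

theorem permImage_mul {k : ℕ} (g h : Equiv.Perm ℕ) (X : Set (Fin k → ℕ)) :
    permImage (g * h) X = permImage g (permImage h X) := by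
  simp [permImage, Set.image_image]

/-- `Aut(Q)`: the group of permutations `g` of `ℕ` such that `X ∈ Q ↔ g(X) ∈ Q` for all
`X ⊆ ℕ^k`. -/
def aut {k : ℕ} (Q : Quantifier k) : Subgroup (Equiv.Perm ℕ) where
  carrier := {g | ∀ X : Set (Fin k → ℕ), X ∈ Q ↔ permImage g X ∈ Q}
  one_mem' := fun X => by rw [permImage_one]
  mul_mem' := fun {g h} hg hh X => by
    rw [permImage_mul, ← hg, ← hh]
  inv_mem' := fun {g} hg X => by
    rw [hg (permImage g⁻¹ X), ← permImage_mul, mul_inv_cancel, permImage_one]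

/-- Formulas of `L_{ω₁ω}(Q)` over the empty signature (equality only), for a quantifier symbol of
type `⟨k⟩`, whose free variables are among `x_0, …, x_{n-1}`. -/
inductive Formula (k : ℕ) : ℕ → Type
  /-- the false formula -/
  | falsum {n : ℕ} : Formula k n
  /-- `x_i = x_j` -/
  | equal {n : ℕ} (i j : Fin n) : Formula k n
  /-- negation -/
  | neg {n : ℕ} (φ : Formula k n) : Formula k n
  /-- conjunction of a countable sequence of formulas -/
  | conj {n : ℕ} (φ : ℕ → Formula k n) : Formula k n
  /-- `∀ x_n, φ` -/
  | all {n : ℕ} (φ : Formula k (n + 1)) : Formula k n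
  /-- `Q x_n … x_{n+k-1}, φ` -/
  | quant {n : ℕ} (φ : Formula k (n + k)) : Formula k n

/-- Satisfaction in `ℕ`, where the quantifier symbol is interpreted as `Q`. -/
def Formula.Realize {k : ℕ} (Q : Quantifier k) : {n : ℕ} → Formula k n → (Fin n → ℕ) → Prop
  | _, .falsum, _ => False
  | _, .equal i j, v => v i = v j
  | _, .neg φ, v => ¬ φ.Realize Q v
  | _, .conj φ, v => ∀ m : ℕ, (φ m).Realize Q v
  | _, .all φ, v => ∀ y : ℕ, φ.Realize Q (Fin.snoc v y)
  | _, .quant φ, v => {x : Fin k → ℕ | φ.Realize Q (Fin.append v x)} ∈ Q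

/-- A set `S ⊆ ℕ^n` is definable in `L_{ω₁ω}(Q)`, without parameters. -/
def Definable {k : ℕ} (Q : Quantifier k) {n : ℕ} (S : Set (Fin n → ℕ)) : Prop :=
  ∃ φ : Formula k n, ∀ v : Fin n → ℕ, v ∈ S ↔ φ.Realize Q v

end GenQuant

/-! The orbit of `a` is the set of tuples satisfying the same formulas as `a`. As ℕ^n is countable,
one formula defines that set (`exists_formula_equivalent`). Automorphisms preserve formulas
(`Formula.realize_comp_of_mem_aut`), so only the converse needs the hypothesis on `Q`.

Back and forth between equivalent tuples builds a permutation `g` whose finite stages are pairs of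
equivalent tuples. It lies in `aut Q` because membership in `Q` is witnessed finitely: `Q` tests
only finitely many inclusions `A ⊆ X`, and each failure is due to a single point. So `X` may be
replaced by a cofinite set definable from a finite tuple (`exists_finite_support`), on which
equivalent tuples agree (`Equivalent.compl_mem_iff`). -/

namespace GenQuant

variable {k : ℕ} {Q : Quantifier k}

/-- A boolean combination of principal quantifiers is decided by which members of some fixed finite
family a set contains. -/
theorem IsBooleanCombinationOfPrincipal.exists_finite_family
    (hQ : IsBooleanCombinationOfPrincipal Q) :
    ∃ F : Set (Set (Fin k → ℕ)), F.Finite ∧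
      ∀ X Y : Set (Fin k → ℕ), (∀ A ∈ F, A ⊆ X ↔ A ⊆ Y) → (X ∈ Q ↔ Y ∈ Q) := by
  unfold IsBooleanCombinationOfPrincipal at hQ
  induction hQ using BooleanSubalgebra.closure_bot_sup_induction with
  | mem P hP =>
    obtain ⟨A, rfl⟩ := hP
    exact ⟨{A}, Set.finite_singleton A, fun X Y h => h A rfl⟩
  | bot => exact ⟨∅, Set.finite_empty, fun X Y _ => Iff.rfl⟩
  | sup P hP R hR ihP ihR =>
    obtain ⟨F, hF, hFP⟩ := ihP
    obtain ⟨G, hG, hGR⟩ := ihR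
    exact ⟨F ∪ G, hF.union hG, fun X Y h => or_congr
      (hFP X Y fun A hA => h A (Or.inl hA)) (hGR X Y fun A hA => h A (Or.inr hA))⟩
  | compl P hP ih =>
    obtain ⟨F, hF, hFP⟩ := ih
    exact ⟨F, hF, fun X Y h => not_congr (hFP X Y h)⟩

/-- Membership of `X` is decided by a cofinite set, obtained by deleting the points outside `X`
whose coordinates are among the entries of a sufficiently rich tuple `p`. -/
theorem IsBooleanCombinationOfPrincipal.exists_finite_support
    (hQ : IsBooleanCombinationOfPrincipal Q) (X : Set (Fin k → ℕ)) :
    ∃ S : Set ℕ, S.Finite ∧ ∀ (m : ℕ) (p : Fin m → ℕ), S ⊆ Set.range p →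
      (X ∈ Q ↔ {x | ∀ σ : Fin k → Fin m, p ∘ σ ∉ X → x ≠ p ∘ σ} ∈ Q) := by
  obtain ⟨F, hF, hFQ⟩ := hQ.exists_finite_family
  have hpt : ∀ A : Set (Fin k → ℕ), ∃ e, ¬ A ⊆ X → e ∈ A ∧ e ∉ X := fun A => by
    by_cases h : A ⊆ X
    -- The value is arbitrary here: `e A` matters only when `A ⊄ X`.
    · exact ⟨0, fun h' => absurd h h'⟩
    · obtain ⟨e, he⟩ := Set.not_subset.1 h
      exact ⟨e, fun _ => he⟩
  choose e he using hpt
  refine ⟨⋃ A ∈ F, Set.range (e A), hF.biUnion fun A _ => Set.finite_range _, ?_⟩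
  intro m p hp
  -- Only points outside `X` are deleted, so inclusions `A ⊆ X` survive. If `A ⊄ X`, the witness `e
  -- A` is itself deleted.
  refine hFQ _ _ fun A hA => ⟨fun h x hx σ hσ hxσ => hσ (hxσ ▸ h hx), fun h => ?_⟩
  by_contra hAX
  have hσ : ∀ i, ∃ j, p j = e A i := fun i =>
    hp (Set.mem_biUnion hA (Set.mem_range_self i))
  choose σ hσ using hσ
  have hσ' : p ∘ σ = e A := funext hσ
  exact h (he A hAX).1 σ (hσ' ▸ (he A hAX).2) hσ'.symm

theorem Formula.exists_iInf (Q : Quantifier k) {ι : Type*} [Countable ι] {n : ℕ}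
    (φ : ι → Formula k n) :
    ∃ ψ : Formula k n, ∀ v, ψ.Realize Q v ↔ ∀ i, (φ i).Realize Q v := by
  cases isEmpty_or_nonempty ι
  · exact ⟨.neg .falsum, fun v => by simp [Formula.Realize]⟩
  · obtain ⟨f, hf⟩ := exists_surjective_nat ι
    exact ⟨.conj fun m => φ (f m), fun v => by
      simpa [Formula.Realize] using (hf.forall (p := fun i => (φ i).Realize Q v)).symm⟩

theorem mem_permImage_comp (g : Equiv.Perm ℕ) (X : Set (Fin k → ℕ)) (x : Fin k → ℕ) :
    g ∘ x ∈ permImage g X ↔ x ∈ X :=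
  Function.Injective.mem_set_image (f := fun (x : Fin k → ℕ) i => g (x i))
    (fun _ _ h => funext fun i => g.injective (congrFun h i))

theorem eq_permImage_iff (g : Equiv.Perm ℕ) (X Y : Set (Fin k → ℕ)) :
    Y = permImage g X ↔ ∀ x, g ∘ x ∈ Y ↔ x ∈ X := by
  refine ⟨fun h x => h ▸ mem_permImage_comp g X x, fun h => Set.ext fun y => ?_⟩
  have hy : y = g ∘ (g.symm ∘ y) := by ext; simp
  rw [hy, h, mem_permImage_comp]

theorem Formula.realize_comp_of_mem_aut {g : Equiv.Perm ℕ} (hg : g ∈ aut Q) {n : ℕ}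
    (φ : Formula k n) (v : Fin n → ℕ) : φ.Realize Q (g ∘ v) ↔ φ.Realize Q v := by
  induction φ with
  | falsum => rfl
  | equal i j => simp [Formula.Realize]
  | neg φ ih => simp [Formula.Realize, ih]
  | conj φ ih => simp [Formula.Realize, ih]
  | all φ ih =>
    simp only [Formula.Realize]
    rw [g.surjective.forall]
    refine forall_congr' fun y => ?_
    rw [← ih (Fin.snoc v y), Fin.comp_snoc]
  | quant φ ih =>
    simp only [Formula.Realize]
    rw [hg {x | φ.Realize Q (Fin.append v x)}]
    refine iff_of_eq (congrArg (· ∈ Q) ?_)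
    refine (eq_permImage_iff g _ _).2 fun x => ?_
    change φ.Realize Q (Fin.append (g ∘ v) (g ∘ x)) ↔ φ.Realize Q (Fin.append v x)
    rw [← ih (Fin.append v x), show g ∘ Fin.append v x = Fin.append (g ∘ v) (g ∘ x) from
      funext (Fin.addCases (by simp) (by simp))]

/-- Two tuples are equivalent if they satisfy the same formulas. -/
def Equivalent (Q : Quantifier k) {n : ℕ} (a b : Fin n → ℕ) : Prop :=
  ∀ φ : Formula k n, φ.Realize Q a ↔ φ.Realize Q b

theorem Equivalent.symm {n : ℕ} {a b : Fin n → ℕ} (h : Equivalent Q a b) : Equivalent Q b a :=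
  fun φ => (h φ).symm

/-- For each of the countably many `b`, choose a formula true of `a` and, when possible, false of
`b`; their conjunction isolates the type of `a`. -/
theorem exists_formula_equivalent (Q : Quantifier k) {n : ℕ} (a : Fin n → ℕ) :
    ∃ φ : Formula k n, ∀ b, φ.Realize Q b ↔ Equivalent Q a b := by
  have hsep : ∀ b : Fin n → ℕ, ∃ χ : Formula k n, χ.Realize Q a ∧
      (χ.Realize Q b → Equivalent Q a b) := fun b => by
    by_cases h : Equivalent Q a b
    · exact ⟨.neg .falsum, by simp [Formula.Realize], fun _ => h⟩
    · obtain ⟨χ, hχ⟩ := not_forall.1 h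
      by_cases ha : χ.Realize Q a
      · exact ⟨χ, ha, fun hb => absurd (iff_of_true ha hb) hχ⟩
      · exact ⟨.neg χ, ha, fun hb => absurd (iff_of_false ha hb) hχ⟩
  choose χ ha hχ using hsep
  obtain ⟨φ, hφ⟩ := Formula.exists_iInf Q χ
  exact ⟨φ, fun b => ⟨fun h => hχ b ((hφ b).1 h b), fun h => (h φ).1 ((hφ a).2 ha)⟩⟩

/-- The extension step of the back and forth: the type of `(a, y)` is isolated by some `φ`, and `∃
φ` passes from `a` to `b`. -/
theorem Equivalent.exists_snoc {n : ℕ} {a b : Fin n → ℕ} (h : Equivalent Q a b) (y : ℕ) :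
    ∃ z : ℕ, Equivalent Q (Fin.snoc a y : Fin (n + 1) → ℕ) (Fin.snoc b z) := by
  obtain ⟨φ, hφ⟩ := exists_formula_equivalent Q (Fin.snoc a y : Fin (n + 1) → ℕ)
  have ha : ¬ (Formula.all (.neg φ)).Realize Q a := fun hall =>
    hall y ((hφ _).2 fun _ => Iff.rfl)
  rw [h] at ha
  simp only [Formula.Realize, not_forall, not_not] at ha
  exact ha.imp fun z => (hφ _).1

theorem Equivalent.apply_eq_iff {n : ℕ} {a b : Fin n → ℕ} (h : Equivalent Q a b) (i j : Fin n) :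
    a i = a j ↔ b i = b j :=
  h (.equal i j)

/-- Equivalent tuples are not distinguished by `Q` on cofinite sets defined from their entries. -/
theorem Equivalent.compl_mem_iff {m : ℕ} {p q : Fin m → ℕ} (h : Equivalent Q p q)
    (T : (Fin k → Fin m) → Prop) :
    {x | ∀ σ, T σ → x ≠ p ∘ σ} ∈ Q ↔ {x | ∀ σ, T σ → x ≠ q ∘ σ} ∈ Q := by
  -- `χ σ` says `x = v ∘ σ`, with the tuple `v` in the first `m` variables and `x` in the last `k`.
  choose χ hχ using fun σ : Fin k → Fin m => Formula.exists_iInf Q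
    fun i : Fin k => (Formula.equal (Fin.natAdd m i) (Fin.castAdd k (σ i)) : Formula k (m + k))
  obtain ⟨φ, hφ⟩ := Formula.exists_iInf Q fun σ : Subtype T => Formula.neg (χ σ.1)
  have key : ∀ v : Fin m → ℕ, {x | φ.Realize Q (Fin.append v x)} =
      {x | ∀ σ, T σ → x ≠ v ∘ σ} := fun v => by
    ext x
    simp [hφ, hχ, Formula.Realize, funext_iff]
  rw [← key, ← key]
  exact h (.quant φ)

/-- A pair of equivalent tuples of the same length. -/
structure EquivalentPair (Q : Quantifier k) where
  length : ℕ
  left : Fin length → ℕ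
  right : Fin length → ℕ
  equivalent : Equivalent Q left right

namespace EquivalentPair

/-- The finite correspondence given by a pair of tuples. -/
def Rel (s : EquivalentPair Q) (x y : ℕ) : Prop := ∃ i, s.left i = x ∧ s.right i = y

/-- Comparing correspondences rather than tuples avoids tracking how indices are embedded from one
stage to the next. -/
instance : Preorder (EquivalentPair Q) where
  le s t := ∀ x y, s.Rel x y → t.Rel x y
  le_refl _ _ _ h := h
  le_trans _ _ _ h h' x y hxy := h' x y (h x y hxy)

theorem Rel.eq_iff {s : EquivalentPair Q} {x y x' y' : ℕ} (h : s.Rel x y) (h' : s.Rel x' y') :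
    x = x' ↔ y = y' := by
  obtain ⟨i, rfl, rfl⟩ := h
  obtain ⟨j, rfl, rfl⟩ := h'
  exact s.equivalent.apply_eq_iff i j

theorem exists_le_of_snoc (s : EquivalentPair Q) {x y : ℕ}
    (h : Equivalent Q (Fin.snoc s.left x : Fin (s.length + 1) → ℕ) (Fin.snoc s.right y)) :
    ∃ t : EquivalentPair Q, t.Rel x y ∧ s ≤ t := by
  refine ⟨⟨_, _, _, h⟩, ⟨Fin.last _, by simp, by simp⟩, ?_⟩
  rintro _ _ ⟨i, rfl, rfl⟩
  exact ⟨i.castSucc, by simp, by simp⟩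

/-- The pairs whose correspondence has `x` in its domain, or `x` in its range. -/
def cofinal (Q : Quantifier k) : ℕ ⊕ ℕ → Order.Cofinal (EquivalentPair Q)
  | .inl x => ⟨{t | ∃ y, t.Rel x y}, fun s => by
      obtain ⟨y, hy⟩ := s.equivalent.exists_snoc x
      obtain ⟨t, ht, hst⟩ := s.exists_le_of_snoc hy
      exact ⟨t, ⟨y, ht⟩, hst⟩⟩
  | .inr y => ⟨{t | ∃ x, t.Rel x y}, fun s => by
      obtain ⟨x, hx⟩ := s.equivalent.symm.exists_snoc y
      obtain ⟨t, ht, hst⟩ := s.exists_le_of_snoc hx.symm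
      exact ⟨t, ⟨x, ht⟩, hst⟩⟩

/-- Back and forth: every pair of equivalent tuples starts a chain of such pairs whose union is a
permutation of `ℕ`. -/
theorem exists_perm (s : EquivalentPair Q) :
    ∃ (g : Equiv.Perm ℕ) (t : ℕ → EquivalentPair Q), Monotone t ∧ t 0 = s ∧
      (∀ n, (t n).right = g ∘ (t n).left) ∧ ∀ x, ∃ n, (t n).Rel x (g x) := by
  let t := Order.sequenceOfCofinals s (cofinal Q)
  have ht : Monotone t := Order.sequenceOfCofinals.monotone s (cofinal Q)
  have hdom : ∀ x, ∃ y n, (t n).Rel x y := fun x =>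
    let ⟨y, hy⟩ := Order.sequenceOfCofinals.encode_mem s (cofinal Q) (.inl x)
    ⟨y, _, hy⟩
  have hran : ∀ y, ∃ x n, (t n).Rel x y := fun y =>
    let ⟨x, hx⟩ := Order.sequenceOfCofinals.encode_mem s (cofinal Q) (.inr y)
    ⟨x, _, hx⟩
  have heq : ∀ {m n x y x' y'}, (t m).Rel x y → (t n).Rel x' y' → (x = x' ↔ y = y') :=
    fun {m n x y x' y'} h h' => Rel.eq_iff (s := t (max m n))
      (ht (le_max_left m n) x y h) (ht (le_max_right m n) x' y' h')
  choose f nf hf using hdom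
  choose f' nf' hf' using hran
  refine ⟨⟨f, f', fun x => (heq (hf' _) (hf _)).2 rfl, fun y => (heq (hf _) (hf' _)).1 rfl⟩, t,
    ht, rfl, fun n => funext fun i => ?_, fun x => ⟨_, hf x⟩⟩
  exact (heq ⟨i, rfl, rfl⟩ (hf ((t n).left i))).1 rfl

end EquivalentPair

theorem Equivalent.mem_orbit (hQ : IsBooleanCombinationOfPrincipal Q) {n : ℕ} {a b : Fin n → ℕ}
    (h : Equivalent Q a b) : b ∈ MulAction.orbit (aut Q) a := by
  obtain ⟨g, t, ht, ht0, hg, hx⟩ := EquivalentPair.exists_perm ⟨n, a, b, h⟩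
  have hgQ : g ∈ aut Q := fun X => by
    obtain ⟨S, hS, hSX⟩ := hQ.exists_finite_support X
    obtain ⟨S', hS', hSX'⟩ := hQ.exists_finite_support (permImage g X)
    choose N hN using hx
    have hfin : (S ∪ g.symm '' S').Finite := hS.union (hS'.image _)
    obtain ⟨M, hM⟩ := (hfin.image N).bddAbove
    -- One stage `M` has all witnesses for `X` in its domain and all those for `g(X)` in its range.
    have hrel : ∀ x ∈ S ∪ g.symm '' S', (t M).Rel x (g x) := fun x hx =>
      ht (hM (Set.mem_image_of_mem N hx)) _ _ (hN x)
    rw [hSX _ (t M).left fun x hx => (hrel x (Or.inl hx)).imp fun _ => And.left,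
      hSX' _ (t M).right fun x hx => (hrel _ (Or.inr (Set.mem_image_of_mem _ hx))).imp
        fun _ h => by simpa using h.2, (t M).equivalent.compl_mem_iff]
    -- As the right tuple is `g` of the left one, the same `σ` index deleted points for `X` and for
    -- `g(X)`.
    simp only [hg M, Function.comp_assoc, mem_permImage_comp]
  refine ⟨⟨g, hgQ⟩, ?_⟩
  have h0 := hg 0
  rw [ht0] at h0
  exact h0.symm

theorem equivalent_of_mem_orbit {n : ℕ} {a b : Fin n → ℕ}
    (h : b ∈ MulAction.orbit (aut Q) a) : Equivalent Q a b := by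
  obtain ⟨g, rfl⟩ := h
  exact fun φ => (φ.realize_comp_of_mem_aut g.2 a).symm

end GenQuant

theorem proposition22 (k : ℕ) (Q : GenQuant.Quantifier k)
    (hQ : GenQuant.IsBooleanCombinationOfPrincipal Q) (n : ℕ) (a : Fin n → ℕ) :
    GenQuant.Definable Q (MulAction.orbit (GenQuant.aut Q) a) := by
  obtain ⟨φ, hφ⟩ := GenQuant.exists_formula_equivalent Q a
  exact ⟨φ, fun v => ⟨fun h => (hφ v).2 (GenQuant.equivalent_of_mem_orbit h),
    fun h => ((hφ v).1 h).mem_orbit hQ⟩⟩
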